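/- Let $\Omega_n=\{0,1\}^n$ carry the uniform probability measure $\mathbf P$ (with expectation $\mathbf E$) and the coordinatewise order; $f:\Omega_n\to\mathbb R$ is monotone if $x\le y$ implies $f(x)\le f(y)$, and an event $\mathcal A\subset\Omega_n$ is monotone if its indicator $\chi_{\mathcal A}$ is. Let $\sigma_kx$ be $x$ with its $k$-th bit flipped, and set $$I_k(f)=\mathbf E\,|f(\sigma_kx)-f(x)|,\qquad I\!I(f)=\sum_{k=1}^n I_k(f)^2 .$$ For $K\subset[n]=\{1,\dots,n\}$ let $M_K(x)\in\{-1,0,1\}$ be the sign of $\sum_{j\in K}(2x_j-1)$, and set $$\Lambda(f)=\max\bigl\{|\mathbf E(fM_K)|:K\subset[n]\bigr\},\qquad \Lambda(\mathcal A)=\Lambda(\chi_{\mathcal A}).$$ For $\epsilon\in(0,1)$ let $N_\epsilon(x)$ be obtained from $x$ by flipping each bit independently with probability $\epsilon$, and put $$\gamma(\mathcal A,\epsilon,\delta)=\mathbf P\bigl\{x:\bigl|\mathbf P(N_\epsilon(x)\in\mathcal A\mid x)-\mathbf P(\mathcal A)\bigr|>\delta\bigr\},\qquad \phi(\mathcal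 A,\epsilon)=\inf\{\delta>0:\gamma(\mathcal A,\epsilon,\delta)<\delta\}.$$ A sequence of events $\mathcal A_m\subset\Omega_{n_m}$ is asymptotically noise sensitive if $\lim_{m\to\infty}\phi(\mathcal A_m,\epsilon)=0$ for every $\epsilon\in(0,1/2)$. **Theorem.** There is a universal constant $C>0$ such that for every $n\ge2$ and every monotone $f:\Omega_n\to[0,1]$, $$I\!I(f)\le C\,\Lambda(f)^2\bigl(1-\log\Lambda(f)\bigr)\log n ,$$ where the right-hand side is read as $0$ if $\Lambda(f)=0$. Consequently, if $n_m\ge2$ and $\mathcal A_m\subset\Omega_{n_m}$ $(m=1,2,\dots)$ is a sequence of monotone events with $$\lim_{m\to\infty}\Lambda(\mathcal A_m)^2\bigl(1-\log\Lambda(\mathcal A_m)\bigr)\log n_m=0 ,$$ the expression again being read as $0$ where $\Lambda(\mathcal A_m)=0$, then $\{\mathcal A_m\}$ is asymptotically noise sensitive. -/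

import Mathlib

open Filter Topology

namespace NoiseSensitivity

/-- The Hamming cube `{0,1}^n`, with the coordinatewise order coming from `false ≤ true`. -/
abbrev Cube (n : ℕ) : Type := Fin n → Bool

/-- Expectation of a real function under the uniform probability measure on the cube. -/
noncomputable def expect {n : ℕ} (f : Cube n → ℝ) : ℝ :=
  (∑ x : Cube n, f x) / 2 ^ n

/-- The indicator function of an event. -/
noncomputable def ind {n : ℕ} (A : Set (Cube n)) : Cube n → ℝ :=
  A.indicator (fun _ => 1)

/-- Uniform probability of an event. -/
noncomputable def prob {n : ℕ} (A : Set (Cube n)) : ℝ :=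
  expect (ind A)

/-- The point obtained from `x` by flipping the `k`-th bit. -/
def flipBit {n : ℕ} (k : Fin n) (x : Cube n) : Cube n :=
  Function.update x k (!(x k))

/-- The influence of the `k`-th variable on `f`: the `L¹` norm of `f (flipBit k x) - f x`. -/
noncomputable def influence {n : ℕ} (k : Fin n) (f : Cube n → ℝ) : ℝ :=
  expect (fun x => |f (flipBit k x) - f x|)

/-- The sum of the squares of the influences. -/
noncomputable def sumSqInfluence {n : ℕ} (f : Cube n → ℝ) : ℝ :=
  ∑ k : Fin n, influence k f ^ 2

/-- The majority function on the set `K` of coordinates, with value `0` at ties. -/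
noncomputable def majority {n : ℕ} (K : Finset (Fin n)) (x : Cube n) : ℝ :=
  if ∑ j ∈ K, ((x j).toNat : ℝ) < (K.card : ℝ) / 2 then -1
  else if ∑ j ∈ K, ((x j).toNat : ℝ) = (K.card : ℝ) / 2 then 0
  else 1

/-- The largest absolute correlation of `f` with a majority function, over all sets `K` of
coordinates. -/
noncomputable def maxMajCorr {n : ℕ} (f : Cube n → ℝ) : ℝ :=
  (Finset.univ : Finset (Finset (Fin n))).sup' Finset.univ_nonempty
    (fun K => |expect (fun x => f x * majority K x)|)

/-- The probability that the noisy copy of `x` equals `y`, each bit of `x` being flipped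
independently with probability `ε`. -/
noncomputable def noiseKernel {n : ℕ} (ε : ℝ) (x y : Cube n) : ℝ :=
  ∏ j : Fin n, if y j = x j then 1 - ε else ε

/-- The conditional probability, given `x`, that the noisy copy of `x` lies in `A`. -/
noncomputable def noiseProb {n : ℕ} (A : Set (Cube n)) (ε : ℝ) (x : Cube n) : ℝ :=
  ∑ y : Cube n, noiseKernel ε x y * ind A y

/-- The probability that `x` is such that knowing `x` shifts the probability that the noisy copy
of `x` lies in `A` by more than `δ`. -/
noncomputable def gammaFn {n : ℕ} (A : Set (Cube n)) (ε δ : ℝ) : ℝ :=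
  prob {x : Cube n | |noiseProb A ε x - prob A| > δ}

/-- The sensitivity gauge of `A`. The set of admissible `δ` contains every `δ > 1` and is
bounded below by `0`. -/
noncomputable def gauge {n : ℕ} (A : Set (Cube n)) (ε : ℝ) : ℝ :=
  sInf {δ : ℝ | 0 < δ ∧ gammaFn A ε δ < δ}

/-- Asymptotic noise sensitivity of a sequence of events. -/
def AsympNoiseSensitive {n : ℕ → ℕ} (A : ∀ m, Set (Cube (n m))) : Prop :=
  ∀ ε : ℝ, 0 < ε → ε < 1 / 2 → Tendsto (fun m => gauge (A m) ε) atTop (𝓝 0)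

/-- An event is monotone if its indicator function is. -/
def MonotoneEvent {n : ℕ} (A : Set (Cube n)) : Prop :=
  Monotone (ind A)

end NoiseSensitivity

open NoiseSensitivity

/-! The two claims meet in `sumSqInfluence`: the first bounds it by majority correlations, and the
second follows once its vanishing is known to force noise sensitivity.

For the bound, monotonicity turns the total influence of `K` into twice the correlation of `f` with
the sign sum `S` over `K`. Truncate `S` at height `T`. Its difference from `T` times majority is a
tail, small by a Chernoff estimate, and an odd function of the level whose correlation with monotone
`f` has a favourable sign (`sum_mul_odd_nonneg`). With `T` of order `√(|K| (1 - log Λ))` this gives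
`sum_influence_sq_le`, valid for every `K`. Removing the smallest influence repeatedly then costs a
harmonic sum, hence `log n` (`sum_sq_le_harmonic`).

For noise sensitivity, apply Poincaré to `noiseOp (1/4) f`. Hölder and the Bonami lemma bound each
derivative term by a mixture of `influence ^ 2` and an energy whose sum over directions is bounded
(`noiseVar_quarter_le`). Cauchy–Schwarz carries the decay from correlation `ρ ^ 2` to `ρ`, hence to
every `ρ < 1`, and Chebyshev converts it to the gauge. -/

namespace NoiseSensitivity

/-! ### Expectation on the cube and bit flips. -/

section Expectation

variable {n : ℕ}

theorem expect_add (f g : Cube n → ℝ) :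
    expect (fun x => f x + g x) = expect f + expect g := by
  simp only [expect, Finset.sum_add_distrib, add_div]

theorem expect_sub (f g : Cube n → ℝ) :
    expect (fun x => f x - g x) = expect f - expect g := by
  simp only [expect, Finset.sum_sub_distrib, sub_div]

theorem expect_const_mul (c : ℝ) (f : Cube n → ℝ) :
    expect (fun x => c * f x) = c * expect f := by
  simp only [expect, ← Finset.mul_sum, mul_div_assoc]

theorem expect_const (c : ℝ) : expect (fun _ : Cube n => c) = c := by
  simp [expect]

theorem expect_mono {f g : Cube n → ℝ} (h : ∀ x, f x ≤ g x) : expect f ≤ expect g :=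
  div_le_div_of_nonneg_right (Finset.sum_le_sum fun x _ => h x) (by positivity)

theorem expect_nonneg {f : Cube n → ℝ} (h : ∀ x, 0 ≤ f x) : 0 ≤ expect f :=
  div_nonneg (Finset.sum_nonneg fun x _ => h x) (by positivity)

theorem abs_expect_le (f : Cube n → ℝ) : |expect f| ≤ expect (fun x => |f x|) := by
  unfold expect
  rw [abs_div, abs_of_pos (by positivity : (0 : ℝ) < 2 ^ n)]
  exact div_le_div_of_nonneg_right (Finset.abs_sum_le_sum_abs _ _) (by positivity)

theorem expect_mul_sq_le (f g : Cube n → ℝ) :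
    expect (fun x => f x * g x) ^ 2 ≤
      expect (fun x => f x ^ 2) * expect (fun x => g x ^ 2) := by
  unfold expect
  rw [div_pow, div_mul_div_comm, ← sq]
  exact div_le_div_of_nonneg_right (Finset.sum_mul_sq_le_sq_mul_sq _ _ _) (by positivity)

theorem flipBit_involutive (k : Fin n) : Function.Involutive (flipBit k) := by
  intro x
  ext j
  by_cases h : j = k
  · subst h; simp [flipBit]
  · simp [flipBit, h]

theorem sum_flipBit (k : Fin n) (f : Cube n → ℝ) : ∑ x, f (flipBit k x) = ∑ x, f x :=
  Equiv.sum_comp (flipBit_involutive k).toPerm f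

theorem expect_flipBit (k : Fin n) (f : Cube n → ℝ) :
    expect (fun x => f (flipBit k x)) = expect f := by
  simp only [expect, sum_flipBit]

end Expectation

/-! ### Splitting off the first bit, the basis for all inductions on dimension. -/

section Slices

variable {n : ℕ}

/-- Prepending a bit to a point of the cube. -/
def consBit (b : Bool) (x : Cube n) : Cube (n + 1) := Fin.cons b x

theorem exists_consBit (x : Cube (n + 1)) : ∃ b y, x = consBit b y :=
  ⟨x 0, Fin.tail x, (Fin.cons_self_tail x).symm⟩

theorem flipBit_zero_consBit (b : Bool) (x : Cube n) :
    flipBit 0 (consBit b x) = consBit (!b) x := by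
  simp [flipBit, consBit]

theorem flipBit_succ_consBit (i : Fin n) (b : Bool) (x : Cube n) :
    flipBit i.succ (consBit b x) = consBit b (flipBit i x) := by
  simp only [flipBit, consBit, Fin.cons_succ]
  rw [Fin.cons_update]

theorem sum_cube_succ (f : Cube (n + 1) → ℝ) :
    ∑ x, f x = ∑ x, f (consBit true x) + ∑ x, f (consBit false x) := by
  rw [← (Fin.consEquiv fun _ : Fin (n + 1) => Bool).sum_comp, Fintype.sum_prod_type,
    Fintype.sum_bool]
  rfl

/-- The average of a function over its first bit. -/
noncomputable def meanPart (f : Cube (n + 1) → ℝ) (x : Cube n) : ℝ :=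
  (f (consBit true x) + f (consBit false x)) / 2

/-- Half the discrete derivative of a function in its first bit. -/
noncomputable def diffPart (f : Cube (n + 1) → ℝ) (x : Cube n) : ℝ :=
  (f (consBit true x) - f (consBit false x)) / 2

theorem expect_succ (f : Cube (n + 1) → ℝ) : expect f = expect (meanPart f) := by
  simp only [expect, meanPart, sum_cube_succ f, ← Finset.sum_div, Finset.sum_add_distrib]
  rw [pow_succ]
  field_simp

theorem expect_sq_succ (f : Cube (n + 1) → ℝ) :
    expect (fun x => f x ^ 2) =
      expect (fun x => meanPart f x ^ 2) + expect (fun x => diffPart f x ^ 2) := by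
  rw [expect_succ, ← expect_add]
  congr 1; ext x
  simp only [meanPart, diffPart]; ring

theorem expect_pow_four_succ (f : Cube (n + 1) → ℝ) :
    expect (fun x => f x ^ 4) = expect (fun x => meanPart f x ^ 4) +
      6 * expect (fun x => meanPart f x ^ 2 * diffPart f x ^ 2) +
        expect (fun x => diffPart f x ^ 4) := by
  rw [expect_succ, ← expect_const_mul, ← expect_add, ← expect_add]
  congr 1; ext x
  simp only [meanPart, diffPart]; ring

end Slices

/-! ### The noise semigroup, hypercontractivity and energy bounds. -/

section NoiseOperator

variable {n : ℕ}

/-- The noise operator with correlation `ρ`. -/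
noncomputable def noiseOp (ρ : ℝ) (f : Cube n → ℝ) (x : Cube n) : ℝ :=
  ∑ y, noiseKernel ((1 - ρ) / 2) x y * f y

/-- The difference operator in direction `i`. -/
def bitDiff (i : Fin n) (f : Cube n → ℝ) (x : Cube n) : ℝ :=
  f (flipBit i x) - f x

theorem noiseOp_linear (ρ a b : ℝ) (f g : Cube n → ℝ) (x : Cube n) :
    noiseOp ρ (fun y => a * f y + b * g y) x = a * noiseOp ρ f x + b * noiseOp ρ g x := by
  simp only [noiseOp, Finset.mul_sum, ← Finset.sum_add_distrib]
  exact Finset.sum_congr rfl fun y _ => by ring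

theorem noiseKernel_comm (ε : ℝ) (x y : Cube n) : noiseKernel ε x y = noiseKernel ε y x := by
  simp only [noiseKernel, eq_comm]

theorem noiseKernel_flipBit (ε : ℝ) (i : Fin n) (x y : Cube n) :
    noiseKernel ε (flipBit i x) (flipBit i y) = noiseKernel ε x y := by
  unfold noiseKernel
  refine Finset.prod_congr rfl fun j _ => ?_
  by_cases h : j = i
  · subst h; simp [flipBit]
  · simp [flipBit, h]

theorem noiseOp_flipBit (ρ : ℝ) (i : Fin n) (f : Cube n → ℝ) (x : Cube n) :
    noiseOp ρ f (flipBit i x) = noiseOp ρ (fun y => f (flipBit i y)) x := by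
  unfold noiseOp
  rw [← sum_flipBit i]
  simp only [noiseKernel_flipBit]

theorem bitDiff_noiseOp (ρ : ℝ) (i : Fin n) (f : Cube n → ℝ) :
    bitDiff i (noiseOp ρ f) = noiseOp ρ (bitDiff i f) := by
  ext x
  have h := noiseOp_linear ρ 1 (-1) (fun y => f (flipBit i y)) f x
  simp only [bitDiff, noiseOp_flipBit]
  rw [show bitDiff i f = fun y => 1 * f (flipBit i y) + -1 * f y by
    ext y; simp only [bitDiff]; ring, h]
  ring

theorem expect_mul_noiseOp (ρ : ℝ) (f g : Cube n → ℝ) :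
    expect (fun x => f x * noiseOp ρ g x) = expect (fun x => noiseOp ρ f x * g x) := by
  simp only [expect, noiseOp, Finset.mul_sum, Finset.sum_mul]
  rw [Finset.sum_comm]
  congr 1
  refine Finset.sum_congr rfl fun x _ => Finset.sum_congr rfl fun y _ => ?_
  rw [noiseKernel_comm]; ring

theorem noiseOp_consBit (ρ : ℝ) (f : Cube (n + 1) → ℝ) (b : Bool) (x : Cube n) :
    noiseOp ρ f (consBit b x) = (1 + ρ) / 2 * noiseOp ρ (fun y => f (consBit b y)) x +
      (1 - ρ) / 2 * noiseOp ρ (fun y => f (consBit (!b) y)) x := by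
  have h (b c : Bool) (x y : Cube n) : noiseKernel ((1 - ρ) / 2) (consBit b x) (consBit c y) =
      (if c = b then (1 + ρ) / 2 else (1 - ρ) / 2) * noiseKernel ((1 - ρ) / 2) x y := by
    simp only [noiseKernel, Fin.prod_univ_succ, consBit, Fin.cons_zero, Fin.cons_succ]
    congr 2; ring
  simp only [noiseOp]
  rw [sum_cube_succ]
  simp only [h, mul_assoc, ← Finset.mul_sum]
  cases b <;> simp [add_comm]

theorem meanPart_noiseOp (ρ : ℝ) (f : Cube (n + 1) → ℝ) :
    meanPart (noiseOp ρ f) = noiseOp ρ (meanPart f) := by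
  ext x
  rw [show meanPart f = fun y => 1 / 2 * f (consBit true y) + 1 / 2 * f (consBit false y) by
    ext y; simp only [meanPart]; ring, noiseOp_linear]
  simp only [meanPart, noiseOp_consBit, Bool.not_true, Bool.not_false]
  ring

/-- Noise acts on the sign character of the first bit as multiplication by `ρ`. With
`meanPart_noiseOp`, this replaces Fourier analysis throughout. -/
theorem diffPart_noiseOp (ρ : ℝ) (f : Cube (n + 1) → ℝ) :
    diffPart (noiseOp ρ f) = fun x => ρ * noiseOp ρ (diffPart f) x := by
  ext x
  rw [show diffPart f = fun y => 1 / 2 * f (consBit true y) + -1 / 2 * f (consBit false y) by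
    ext y; simp only [diffPart]; ring, noiseOp_linear]
  simp only [diffPart, noiseOp_consBit, Bool.not_true, Bool.not_false]
  ring

theorem eq_of_parts_eq {f g : Cube (n + 1) → ℝ} (h₁ : meanPart f = meanPart g)
    (h₂ : diffPart f = diffPart g) : f = g := by
  ext x
  obtain ⟨b, y, rfl⟩ := exists_consBit x
  have h₁ := congrFun h₁ y
  have h₂ := congrFun h₂ y
  simp only [meanPart, diffPart] at h₁ h₂
  cases b <;> linarith

theorem meanPart_bitDiff_succ (i : Fin n) (f : Cube (n + 1) → ℝ) :
    meanPart (bitDiff i.succ f) = bitDiff i (meanPart f) := by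
  ext x; simp only [meanPart, bitDiff, flipBit_succ_consBit]; ring

theorem diffPart_bitDiff_succ (i : Fin n) (f : Cube (n + 1) → ℝ) :
    diffPart (bitDiff i.succ f) = bitDiff i (diffPart f) := by
  ext x; simp only [diffPart, bitDiff, flipBit_succ_consBit]; ring

theorem expect_bitDiff_zero_sq (f : Cube (n + 1) → ℝ) :
    expect (fun x => bitDiff 0 f x ^ 2) = 4 * expect (fun x => diffPart f x ^ 2) := by
  rw [expect_succ, ← expect_const_mul]
  congr 1; ext x
  simp only [meanPart, diffPart, bitDiff, flipBit_zero_consBit, Bool.not_true, Bool.not_false]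
  ring

theorem sum_expect_bitDiff_sq_succ (f : Cube (n + 1) → ℝ) :
    ∑ i, expect (fun x => bitDiff i f x ^ 2) = 4 * expect (fun x => diffPart f x ^ 2) +
      (∑ i, expect (fun x => bitDiff i (meanPart f) x ^ 2) +
        ∑ i, expect (fun x => bitDiff i (diffPart f) x ^ 2)) := by
  rw [Fin.sum_univ_succ, expect_bitDiff_zero_sq, ← Finset.sum_add_distrib]
  simp only [expect_sq_succ, meanPart_bitDiff_succ, diffPart_bitDiff_succ]

theorem noiseOp_zero_dim (ρ : ℝ) (f : Cube 0 → ℝ) : noiseOp ρ f = f := by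
  ext x
  rw [Subsingleton.elim x default]
  simp only [noiseOp, noiseKernel, Fintype.sum_unique, Finset.univ_eq_empty,
    Finset.prod_empty, one_mul]
  exact congrArg f (Subsingleton.elim _ _)

theorem noiseOp_noiseOp (ρ σ : ℝ) (f : Cube n → ℝ) :
    noiseOp ρ (noiseOp σ f) = noiseOp (ρ * σ) f := by
  induction n with
  | zero => simp only [noiseOp_zero_dim]
  | succ n ih =>
    apply eq_of_parts_eq
    · simp only [meanPart_noiseOp, ih]
    · ext x
      have h := noiseOp_linear ρ σ 0 (noiseOp σ (diffPart f)) 0 x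
      simp only [Pi.zero_apply, mul_zero, add_zero, zero_mul, ih] at h
      simp only [diffPart_noiseOp, h]
      ring

theorem noiseOp_const (ρ c : ℝ) : noiseOp ρ (fun _ : Cube n => c) = fun _ => c := by
  induction n with
  | zero => simp only [noiseOp_zero_dim]
  | succ n ih =>
    apply eq_of_parts_eq
    · rw [meanPart_noiseOp]
      have hm : meanPart (fun _ : Cube (n + 1) => c) = fun _ => c := by ext; simp [meanPart]
      rw [hm, ih]
    · have h0 : diffPart (fun _ : Cube (n + 1) => c) = fun _ => 0 := by ext; simp [diffPart]
      ext x
      simp [diffPart_noiseOp, h0, noiseOp]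

theorem expect_noiseOp (ρ : ℝ) (f : Cube n → ℝ) : expect (noiseOp ρ f) = expect f := by
  have h := expect_mul_noiseOp ρ (fun _ => 1) f
  rw [noiseOp_const] at h
  simpa using h

theorem expect_noiseOp_sq_le {ρ : ℝ} (hρ : ρ ^ 2 ≤ 1) (f : Cube n → ℝ) :
    expect (fun x => noiseOp ρ f x ^ 2) ≤ expect (fun x => f x ^ 2) := by
  induction n with
  | zero => simp only [noiseOp_zero_dim, le_refl]
  | succ n ih =>
    rw [expect_sq_succ, expect_sq_succ, meanPart_noiseOp, diffPart_noiseOp]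
    simp only [mul_pow, expect_const_mul]
    refine add_le_add (ih _) (le_trans ?_ (ih _))
    exact mul_le_of_le_one_left (expect_nonneg fun x => sq_nonneg _) hρ

theorem expect_abs_noiseOp_le {ρ : ℝ} (hρ : |ρ| ≤ 1) (f : Cube n → ℝ) :
    expect (fun x => |noiseOp ρ f x|) ≤ expect (fun x => |f x|) := by
  rw [← expect_noiseOp ρ fun x => |f x|]
  refine expect_mono fun x => (Finset.abs_sum_le_sum_abs _ _).trans_eq ?_
  refine Finset.sum_congr rfl fun y _ => ?_
  rw [abs_mul, abs_of_nonneg]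
  have := abs_le.1 hρ
  refine Finset.prod_nonneg fun j _ => ?_
  split_ifs <;> linarith

/-- The Bonami lemma: the noise operator is a contraction from `L²` to `L⁴`. -/
theorem expect_noiseOp_pow_four_le {ρ : ℝ} (hρ : 3 * ρ ^ 2 ≤ 1) (f : Cube n → ℝ) :
    expect (fun x => noiseOp ρ f x ^ 4) ≤ expect (fun x => f x ^ 2) ^ 2 := by
  induction n with
  | zero =>
    simp [noiseOp_zero_dim, expect, ← pow_mul]
  | succ n ih =>
    rw [expect_pow_four_succ, expect_sq_succ, meanPart_noiseOp, diffPart_noiseOp]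
    set a := meanPart f
    set b := diffPart f
    have ha := ih a
    have hb := ih b
    have h := expect_mul_sq_le (fun x => noiseOp ρ a x ^ 2) (fun x => noiseOp ρ b x ^ 2)
    simp only [← pow_mul, Nat.reduceMul] at h
    have e₁ : expect (fun x => noiseOp ρ a x ^ 2 * (ρ * noiseOp ρ b x) ^ 2) =
        ρ ^ 2 * expect (fun x => noiseOp ρ a x ^ 2 * noiseOp ρ b x ^ 2) := by
      rw [← expect_const_mul]; congr 1; ext x; ring
    have e₂ : expect (fun x => (ρ * noiseOp ρ b x) ^ 4) =
        ρ ^ 4 * expect (fun x => noiseOp ρ b x ^ 4) := by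
      rw [← expect_const_mul]; congr 1; ext x; ring
    rw [e₁, e₂]
    have hA : 0 ≤ expect (fun x => a x ^ 2) := expect_nonneg fun x => sq_nonneg _
    have hB : 0 ≤ expect (fun x => b x ^ 2) := expect_nonneg fun x => sq_nonneg _
    have hb0 : 0 ≤ expect (fun x => noiseOp ρ b x ^ 4) := expect_nonneg fun x => by positivity
    have hm0 : 0 ≤ expect (fun x => noiseOp ρ a x ^ 2 * noiseOp ρ b x ^ 2) :=
      expect_nonneg fun x => by positivity
    have hm : expect (fun x => noiseOp ρ a x ^ 2 * noiseOp ρ b x ^ 2) ≤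
        expect (fun x => a x ^ 2) * expect (fun x => b x ^ 2) := by
      refine (sq_le_sq₀ hm0 (mul_nonneg hA hB)).1 ?_
      rw [mul_pow]
      exact h.trans (mul_le_mul ha hb hb0 (sq_nonneg _))
    have h4 : ρ ^ 4 ≤ 1 := by nlinarith [sq_nonneg ρ]
    -- Here `3 * ρ ^ 2 ≤ 1` is used: the mixed term has coefficient `6 * ρ ^ 2 ≤ 2`, just what `(A +
    -- B) ^ 2` allows.
    have t₁ := mul_le_mul_of_nonneg_right hρ hm0
    have t₂ := mul_le_mul_of_nonneg_right h4 hb0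
    nlinarith

/-- The Poincaré inequality on the cube. -/
theorem poincare (f : Cube n → ℝ) :
    4 * (expect (fun x => f x ^ 2) - expect f ^ 2) ≤
      ∑ i, expect (fun x => bitDiff i f x ^ 2) := by
  induction n with
  | zero => simp [expect]
  | succ n ih =>
    rw [sum_expect_bitDiff_sq_succ, expect_sq_succ, expect_succ]
    have h : 0 ≤ ∑ i, expect (fun x => bitDiff i (diffPart f) x ^ 2) :=
      Finset.sum_nonneg fun i _ => expect_nonneg fun x => sq_nonneg _
    linarith [ih (meanPart f)]

/-- In Fourier terms, `4 * k * ρ ^ (2 * k)` is bounded in the degree `k`. The hypothesis `h` says `4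
* ρ ^ 2 + V * ρ ^ 2 ≤ V`, which closes the induction on the difference part. -/
theorem sum_expect_bitDiff_noiseOp_sq_le {ρ V : ℝ} (hV : 0 ≤ V) (hρ : ρ ^ 2 ≤ 1)
    (h : 4 * ρ ^ 2 ≤ V * (1 - ρ ^ 2)) (f : Cube n → ℝ) :
    ∑ i, expect (fun x => bitDiff i (noiseOp ρ f) x ^ 2) ≤ V * expect (fun x => f x ^ 2) := by
  induction n with
  | zero => simpa using mul_nonneg hV (expect_nonneg fun x => sq_nonneg (f x))
  | succ n ih =>
    have e (i : Fin n) (x : Cube n) :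
        bitDiff i (fun y => ρ * noiseOp ρ (diffPart f) y) x ^ 2 =
          ρ ^ 2 * bitDiff i (noiseOp ρ (diffPart f)) x ^ 2 := by
      simp only [bitDiff]; ring
    rw [sum_expect_bitDiff_sq_succ, expect_sq_succ f, meanPart_noiseOp, diffPart_noiseOp]
    simp only [e, mul_pow, expect_const_mul, ← Finset.mul_sum]
    have h₁ := ih (meanPart f)
    have h₂ := mul_le_mul_of_nonneg_left (ih (diffPart f)) (sq_nonneg ρ)
    have h₃ := mul_le_mul_of_nonneg_left (expect_noiseOp_sq_le hρ (diffPart f)) (sq_nonneg ρ)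
    have h₄ := mul_le_mul_of_nonneg_right h
      (expect_nonneg fun x => sq_nonneg (diffPart f x))
    linarith

end NoiseOperator

/-! ### Noise variance and its control by influences. -/

section Variance

variable {n : ℕ}

/-- The second moment of the noised version of the centred function. -/
noncomputable def noiseVar (ρ : ℝ) (f : Cube n → ℝ) : ℝ :=
  expect (fun x => noiseOp ρ (fun y => f y - expect f) x ^ 2)

theorem noiseOp_center (ρ : ℝ) (f : Cube n → ℝ) (x : Cube n) :
    noiseOp ρ (fun y => f y - expect f) x = noiseOp ρ f x - expect f := by
  have h := noiseOp_linear ρ 1 (-1) f (fun _ => expect f) x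
  rw [noiseOp_const] at h
  simp only [one_mul, neg_one_mul, ← sub_eq_add_neg] at h
  exact h

theorem expect_sub_sq (g : Cube n → ℝ) (c : ℝ) (hc : expect g = c) :
    expect (fun x => (g x - c) ^ 2) = expect (fun x => g x ^ 2) - c ^ 2 := by
  have e : (fun x => (g x - c) ^ 2) = fun x => g x ^ 2 - (2 * c * g x - c ^ 2) := by
    ext x; ring
  rw [e, expect_sub, expect_sub, expect_const_mul, expect_const, hc]
  ring

theorem noiseVar_eq (ρ : ℝ) (f : Cube n → ℝ) :
    noiseVar ρ f = expect (fun x => noiseOp ρ f x ^ 2) - expect f ^ 2 := by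
  simp only [noiseVar, noiseOp_center]
  exact expect_sub_sq _ _ (expect_noiseOp ρ f)

theorem noiseVar_nonneg (ρ : ℝ) (f : Cube n → ℝ) : 0 ≤ noiseVar ρ f :=
  expect_nonneg fun _ => sq_nonneg _

theorem expect_noiseOp_sq (ρ : ℝ) (g : Cube n → ℝ) :
    expect (fun x => noiseOp ρ g x ^ 2) = expect (fun x => g x * noiseOp (ρ ^ 2) g x) := by
  rw [sq ρ, ← noiseOp_noiseOp, expect_mul_noiseOp]
  simp only [sq]

theorem noiseVar_mul_le {σ : ℝ} (hσ : σ ^ 2 ≤ 1) (ρ : ℝ) (f : Cube n → ℝ) :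
    noiseVar (σ * ρ) f ≤ noiseVar ρ f := by
  unfold noiseVar
  rw [← noiseOp_noiseOp]
  exact expect_noiseOp_sq_le hσ _

theorem expect_sq_le_one {f : Cube n → ℝ} (h01 : ∀ x, f x ∈ Set.Icc (0 : ℝ) 1) :
    expect (fun x => f x ^ 2) ≤ 1 :=
  (expect_mono fun x => pow_le_one₀ (h01 x).1 (h01 x).2).trans_eq (expect_const 1)

/-- By self-adjointness `noiseVar ρ f` pairs the centred `f` with its `ρ ^ 2`-noised version; apply
Cauchy–Schwarz. -/
theorem noiseVar_sq_le {f : Cube n → ℝ} (h01 : ∀ x, f x ∈ Set.Icc (0 : ℝ) 1) (ρ : ℝ) :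
    noiseVar ρ f ^ 2 ≤ noiseVar (ρ ^ 2) f := by
  have h := expect_mul_sq_le (fun y => f y - expect f)
    (noiseOp (ρ ^ 2) fun y => f y - expect f)
  rw [← expect_noiseOp_sq, expect_sub_sq f _ rfl] at h
  refine h.trans (mul_le_of_le_one_left (noiseVar_nonneg _ f) ?_)
  linarith [expect_sq_le_one h01, sq_nonneg (expect f)]

/-- Hölder with exponents 4/3 and 4, done as two Cauchy–Schwarz steps; the `L⁴` norm of the noised
factor is removed by the Bonami lemma. -/
theorem expect_mul_noiseOp_pow_four_le {ρ : ℝ} (hρ : 3 * ρ ^ 2 ≤ 1) (u : Cube n → ℝ) :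
    expect (fun x => u x * noiseOp ρ u x) ^ 4 ≤
      expect (fun x => |u x|) ^ 2 * expect (fun x => u x ^ 2) ^ 3 := by
  set v := noiseOp ρ u
  have hI : 0 ≤ expect (fun x => |u x|) := expect_nonneg fun x => abs_nonneg _
  have hq : 0 ≤ expect (fun x => u x ^ 2) := expect_nonneg fun x => sq_nonneg _
  have h₁ : expect (fun x => u x * v x) ^ 2 ≤
      expect (fun x => |u x|) * expect (fun x => |u x| * v x ^ 2) := by
    have h := expect_mul_sq_le (fun x => √|u x|) (fun x => √|u x| * |v x|)
    simp only [mul_pow, Real.sq_sqrt (abs_nonneg _), sq_abs, ← mul_assoc,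
      Real.mul_self_sqrt (abs_nonneg _), ← abs_mul] at h
    refine le_trans ?_ h
    rw [← sq_abs]
    exact pow_le_pow_left₀ (abs_nonneg _) (abs_expect_le _) 2
  have h₂ : expect (fun x => |u x| * v x ^ 2) ^ 2 ≤ expect (fun x => u x ^ 2) ^ 3 := by
    have h := expect_mul_sq_le (fun x => |u x|) (fun x => v x ^ 2)
    simp only [sq_abs, ← pow_mul, Nat.reduceMul] at h
    refine h.trans ((mul_le_mul_of_nonneg_left (expect_noiseOp_pow_four_le hρ u) hq).trans_eq ?_)
    ring
  calc expect (fun x => u x * v x) ^ 4 = (expect (fun x => u x * v x) ^ 2) ^ 2 := by ring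
    _ ≤ (expect (fun x => |u x|) * expect (fun x => |u x| * v x ^ 2)) ^ 2 :=
        pow_le_pow_left₀ (sq_nonneg _) h₁ 2
    _ = expect (fun x => |u x|) ^ 2 * expect (fun x => |u x| * v x ^ 2) ^ 2 := mul_pow _ _ _
    _ ≤ _ := mul_le_mul_of_nonneg_left h₂ (sq_nonneg _)

/-- A weighted Young inequality. It makes the Hölder bound linear in `a ^ 2` and `b`, so that it can
be summed over directions. -/
theorem le_of_pow_four_le {r a b t : ℝ} (hb : 0 ≤ b) (ht : 0 < t)
    (h : r ^ 4 ≤ a ^ 2 * b ^ 3) : r ≤ a ^ 2 / t ^ 3 + t * b := by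
  have h₁ : 0 ≤ a ^ 2 / t ^ 3 := by positivity
  have h₂ : 0 ≤ t * b := by positivity
  refine le_of_pow_le_pow_left₀ (n := 4) (by norm_num) (add_nonneg h₁ h₂) (h.trans ?_)
  calc a ^ 2 * b ^ 3 = (a ^ 2 / t ^ 3) * (t * b) ^ 3 := by field_simp
    _ ≤ (a ^ 2 / t ^ 3 + t * b) * (a ^ 2 / t ^ 3 + t * b) ^ 3 := by gcongr <;> linarith
    _ = _ := by ring

theorem noiseVar_quarter_le {f : Cube n → ℝ} (h01 : ∀ x, f x ∈ Set.Icc (0 : ℝ) 1) {t : ℝ}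
    (ht : 0 < t) : noiseVar (1 / 4) f ≤ sumSqInfluence f / t ^ 3 + t := by
  set q : Fin n → ℝ := fun i => expect (fun x => bitDiff i (noiseOp (1 / 2) f) x ^ 2) with hq
  -- The value 4/3 gives equality in `4 * ρ ^ 2 ≤ V * (1 - ρ ^ 2)` at `ρ = 1/2`.
  have hQ : ∑ i, q i ≤ 4 / 3 := by
    have h := sum_expect_bitDiff_noiseOp_sq_le (ρ := 1 / 2) (V := 4 / 3) (by norm_num)
      (by norm_num) (by norm_num) f
    linarith [expect_sq_le_one h01]
  have hi (i : Fin n) : expect (fun x => bitDiff i (noiseOp (1 / 4) f) x ^ 2) ≤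
      influence i f ^ 2 / t ^ 3 + t * q i := by
    -- Half of the noise stays inside `q` to keep the energy summable; the other half supplies
    -- hypercontractivity.
    have e : bitDiff i (noiseOp (1 / 4) f) =
        noiseOp (1 / 2) (bitDiff i (noiseOp (1 / 2) f)) := by
      rw [← bitDiff_noiseOp, noiseOp_noiseOp]; norm_num
    rw [e, expect_noiseOp_sq]
    have hq0 : 0 ≤ q i := expect_nonneg fun _ => sq_nonneg _
    refine le_of_pow_four_le hq0 ht
      ((expect_mul_noiseOp_pow_four_le (by norm_num) _).trans ?_)
    refine mul_le_mul_of_nonneg_right ?_ (pow_nonneg hq0 3)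
    refine pow_le_pow_left₀ (expect_nonneg fun _ => abs_nonneg _) ?_ 2
    rw [bitDiff_noiseOp]
    exact expect_abs_noiseOp_le (by norm_num [abs_of_pos]) _
  have hP := (poincare (noiseOp (1 / 4) f)).trans (Finset.sum_le_sum fun i _ => hi i)
  rw [expect_noiseOp, ← noiseVar_eq, Finset.sum_add_distrib, ← Finset.sum_div,
    ← Finset.mul_sum] at hP
  have h₁ := mul_le_mul_of_nonneg_left hQ ht.le
  have h₂ : 0 ≤ sumSqInfluence f / t ^ 3 :=
    div_nonneg (Finset.sum_nonneg fun i _ => sq_nonneg _) (by positivity)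
  have h₃ : (∑ i, influence i f ^ 2) / t ^ 3 = sumSqInfluence f / t ^ 3 := rfl
  linarith

end Variance

/-! ### From vanishing influences to asymptotic noise sensitivity. -/

section Sequences

variable {n : ℕ → ℕ} {f : ∀ m, Cube (n m) → ℝ}

theorem tendsto_noiseVar_quarter (h01 : ∀ m x, f m x ∈ Set.Icc (0 : ℝ) 1)
    (h : Tendsto (fun m => sumSqInfluence (f m)) atTop (𝓝 0)) :
    Tendsto (fun m => noiseVar (1 / 4) (f m)) atTop (𝓝 0) := by
  refine (tendsto_order.2 ⟨fun a ha => Eventually.of_forall fun m =>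
    ha.trans_le (noiseVar_nonneg _ _), fun a ha => ?_⟩)
  have ht : 0 < a / 2 := by positivity
  have h' := (h.div_const ((a / 2) ^ 3)).add_const (a / 2)
  rw [zero_div, zero_add] at h'
  filter_upwards [h'.eventually_lt_const (half_lt_self ha)] with m hm
  exact (noiseVar_quarter_le (h01 m) ht).trans_lt hm

theorem tendsto_noiseVar_of_sq (h01 : ∀ m x, f m x ∈ Set.Icc (0 : ℝ) 1) {ρ : ℝ}
    (h : Tendsto (fun m => noiseVar (ρ ^ 2) (f m)) atTop (𝓝 0)) :
    Tendsto (fun m => noiseVar ρ (f m)) atTop (𝓝 0) := by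
  have h' := h.sqrt
  rw [Real.sqrt_zero] at h'
  exact squeeze_zero (fun m => noiseVar_nonneg _ _)
    (fun m => Real.le_sqrt_of_sq_le (noiseVar_sq_le (h01 m) ρ)) h'

theorem tendsto_noiseVar (h01 : ∀ m x, f m x ∈ Set.Icc (0 : ℝ) 1)
    (h : Tendsto (fun m => sumSqInfluence (f m)) atTop (𝓝 0)) {ρ : ℝ} (h0 : 0 ≤ ρ) (h1 : ρ < 1) :
    Tendsto (fun m => noiseVar ρ (f m)) atTop (𝓝 0) := by
  -- Repeated squaring brings any `ρ < 1` below 1/4, where decay is known; each squaring is undone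
  -- by `tendsto_noiseVar_of_sq`.
  have key (k : ℕ) : ∀ σ : ℝ, Tendsto (fun m => noiseVar (σ ^ 2 ^ k) (f m)) atTop (𝓝 0) →
      Tendsto (fun m => noiseVar σ (f m)) atTop (𝓝 0) := by
    induction k with
    | zero => intro σ hσ; simpa using hσ
    | succ k ih =>
      intro σ hσ
      refine tendsto_noiseVar_of_sq h01 (ih _ ?_)
      rwa [← pow_mul, ← pow_succ']
  obtain ⟨k, hk⟩ := exists_pow_lt_of_lt_one (show (0 : ℝ) < 1 / 4 by norm_num) h1
  refine key k ρ (squeeze_zero (fun m => noiseVar_nonneg _ _) (fun m => ?_)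
    (tendsto_noiseVar_quarter h01 h))
  have hle : ρ ^ 2 ^ k ≤ 1 / 4 :=
    (pow_le_pow_of_le_one h0 h1.le k.lt_two_pow_self.le).trans hk.le
  have hnn : 0 ≤ ρ ^ 2 ^ k := pow_nonneg h0 _
  have := noiseVar_mul_le (σ := 4 * ρ ^ 2 ^ k) (pow_le_one₀ (by linarith) (by linarith))
    (1 / 4) (f m)
  rwa [show 4 * ρ ^ 2 ^ k * (1 / 4) = ρ ^ 2 ^ k by ring] at this

theorem ind_mem_Icc {n : ℕ} (A : Set (Cube n)) (x : Cube n) : ind A x ∈ Set.Icc (0 : ℝ) 1 := by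
  unfold ind Set.indicator
  split_ifs <;> simp

theorem noiseProb_eq {n : ℕ} (A : Set (Cube n)) (ε : ℝ) :
    noiseProb A ε = noiseOp (1 - 2 * ε) (ind A) := by
  ext x
  rw [noiseProb, noiseOp, show (1 - (1 - 2 * ε)) / 2 = ε by ring]

/-- Chebyshev's inequality for the noise probability. -/
theorem gammaFn_mul_sq_le {n : ℕ} (A : Set (Cube n)) (ε : ℝ) {δ : ℝ} (hδ : 0 < δ) :
    gammaFn A ε δ * δ ^ 2 ≤ noiseVar (1 - 2 * ε) (ind A) := by
  rw [gammaFn, prob, mul_comm, ← expect_const_mul]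
  refine expect_mono fun x => ?_
  rw [noiseOp_center, ← noiseProb_eq]
  unfold ind Set.indicator
  split_ifs with hx
  · rw [mul_one, ← sq_abs (noiseProb A ε x - _)]
    exact pow_le_pow_left₀ hδ.le (le_of_lt hx) 2
  · rw [mul_zero]; exact sq_nonneg _

theorem gauge_nonneg {n : ℕ} (A : Set (Cube n)) (ε : ℝ) : 0 ≤ gauge A ε :=
  Real.sInf_nonneg fun _ h => h.1.le

theorem gauge_le {n : ℕ} {A : Set (Cube n)} {ε δ : ℝ} (hδ : 0 < δ)
    (h : noiseVar (1 - 2 * ε) (ind A) < δ ^ 3) : gauge A ε ≤ δ := by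
  refine csInf_le ⟨0, fun _ h => h.1.le⟩ ⟨hδ, ?_⟩
  have := (gammaFn_mul_sq_le A ε hδ).trans_lt h
  exact lt_of_mul_lt_mul_right (this.trans_eq (by ring)) (sq_nonneg δ)

theorem asympNoiseSensitive_of_tendsto_sumSqInfluence (A : ∀ m, Set (Cube (n m)))
    (h : Tendsto (fun m => sumSqInfluence (ind (A m))) atTop (𝓝 0)) :
    AsympNoiseSensitive A := by
  intro ε hε hε2
  have hv := tendsto_noiseVar (fun m => ind_mem_Icc (A m)) h (ρ := 1 - 2 * ε) (by linarith)
    (by linarith)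
  refine (tendsto_order.2 ⟨fun a ha => Eventually.of_forall fun m =>
    ha.trans_le (gauge_nonneg _ _), fun a ha => ?_⟩)
  filter_upwards [hv.eventually_lt_const (show 0 < (a / 2) ^ 3 by positivity)] with m hm
  exact (gauge_le (by positivity) hm).trans_lt (half_lt_self ha)

end Sequences

/-! ### Monotone functions on the levels of a coordinate set. -/

section Levels

variable {n : ℕ}

/-- The number of ones of `x` in the coordinates `K`. -/
def onesIn (K : Finset (Fin n)) (x : Cube n) : ℕ := ∑ j ∈ K, (x j).toNat

theorem onesIn_le (K : Finset (Fin n)) (x : Cube n) : onesIn K x ≤ K.card := by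
  simpa [onesIn] using Finset.sum_le_card_nsmul K (fun j => (x j).toNat) 1 fun j _ => Bool.toNat_le _

theorem onesIn_flipBit {K : Finset (Fin n)} {j : Fin n} (hj : j ∈ K) {x : Cube n}
    (hx : x j = false) : onesIn K (flipBit j x) = onesIn K x + 1 := by
  unfold onesIn
  rw [← Finset.add_sum_erase K _ hj, ← Finset.add_sum_erase K _ hj]
  have h : ∑ i ∈ K.erase j, (flipBit j x i).toNat = ∑ i ∈ K.erase j, (x i).toNat :=
    Finset.sum_congr rfl fun i hi => by simp [flipBit, Finset.ne_of_mem_erase hi]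
  rw [h]
  simp [flipBit, hx, add_comm]

theorem card_filter_true (K : Finset (Fin n)) (x : Cube n) :
    (K.filter fun j => x j = true).card = onesIn K x := by
  rw [onesIn, Finset.card_filter]
  exact Finset.sum_congr rfl fun j _ => by cases x j <;> simp

theorem card_filter_false (K : Finset (Fin n)) (x : Cube n) :
    (K.filter fun j => x j = false).card = K.card - onesIn K x := by
  have h := Finset.card_filter_add_card_filter_not (s := K) (fun j => x j = true)
  simp only [Bool.not_eq_true, card_filter_true] at h
  omega

theorem le_flipBit {j : Fin n} {x : Cube n} (hx : x j = false) : x ≤ flipBit j x := by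
  intro i
  by_cases h : i = j
  · subst h; simp [hx]
  · simp [flipBit, h]

/-- The sum of `f` over the points with `k` ones in the coordinates `K`. -/
noncomputable def levelSum (K : Finset (Fin n)) (f : Cube n → ℝ) (k : ℕ) : ℝ :=
  ∑ x with onesIn K x = k, f x

/-- Double counting of pairs of a point and a coordinate in `K`: flipping a 0 at level `k` gives a 1
at level `k + 1` without decreasing `f`. -/
theorem levelSum_succ_ge {f : Cube n → ℝ} (hf : Monotone f) (K : Finset (Fin n)) {k : ℕ}
    (hk : k ≤ K.card) :
    ((K.card : ℝ) - k) * levelSum K f k ≤ (k + 1) * levelSum K f (k + 1) := by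
  have h₁ : ((K.card : ℝ) - k) * levelSum K f k =
      ∑ j ∈ K, ∑ x, if onesIn K x = k ∧ x j = false then f x else 0 := by
    rw [Finset.sum_comm, levelSum, Finset.mul_sum, Finset.sum_filter]
    refine Finset.sum_congr rfl fun x _ => ?_
    by_cases hx : onesIn K x = k
    · simp only [hx, true_and, if_true]
      rw [← Finset.sum_filter, Finset.sum_const, card_filter_false, hx, nsmul_eq_mul,
        Nat.cast_sub hk]
    · simp [hx]
  have h₂ : ((k : ℝ) + 1) * levelSum K f (k + 1) =
      ∑ j ∈ K, ∑ x, if onesIn K x = k + 1 ∧ x j = true then f x else 0 := by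
    rw [Finset.sum_comm, levelSum, Finset.mul_sum, Finset.sum_filter]
    refine Finset.sum_congr rfl fun x _ => ?_
    by_cases hx : onesIn K x = k + 1
    · simp only [hx, true_and, if_true]
      rw [← Finset.sum_filter, Finset.sum_const, card_filter_true, hx, nsmul_eq_mul]
      push_cast; ring
    · simp [hx]
  rw [h₁, h₂]
  refine Finset.sum_le_sum fun j hj => ?_
  rw [← sum_flipBit j fun x => if onesIn K x = k + 1 ∧ x j = true then f x else 0]
  refine Finset.sum_le_sum fun x _ => ?_
  cases hx : x j
  · have hx' : flipBit j x j = true := by simp [flipBit, hx]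
    simp only [onesIn_flipBit hj hx, hx', add_left_inj, and_true]
    split_ifs
    · exact hf (le_flipBit hx)
    · exact le_rfl
  · have hx' : flipBit j x j = false := by simp [flipBit, hx]
    simp [hx']

/-- Level sums divided by binomial coefficients increase with the level, and opposite levels have
equal coefficients. -/
theorem levelSum_reflect_le {f : Cube n → ℝ} (hf : Monotone f) (K : Finset (Fin n)) {k : ℕ}
    (hk : 2 * k ≤ K.card) : levelSum K f k ≤ levelSum K f (K.card - k) := by
  set m := K.card with hm
  have step (l : ℕ) (hl : l < m) :
      levelSum K f l / m.choose l ≤ levelSum K f (l + 1) / m.choose (l + 1) := by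
    have h := levelSum_succ_ge hf K hl.le
    have c₀ : (0 : ℝ) < m.choose l := by exact_mod_cast Nat.choose_pos hl.le
    have c₁ : (0 : ℝ) < m.choose (l + 1) := by exact_mod_cast Nat.choose_pos hl
    have e : (m.choose (l + 1) : ℝ) * (l + 1) = m.choose l * ((m : ℝ) - l) := by
      rw [← Nat.cast_sub hl.le]
      exact_mod_cast Nat.choose_succ_right_eq m l
    rw [div_le_div_iff₀ c₀ c₁]
    have hl' : (0 : ℝ) < l + 1 := by positivity
    refine le_of_mul_le_mul_left ?_ hl'
    calc (l + 1 : ℝ) * (levelSum K f l * m.choose (l + 1))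
        = levelSum K f l * (m.choose (l + 1) * (l + 1)) := by ring
      _ = m.choose l * (((m : ℝ) - l) * levelSum K f l) := by rw [e]; ring
      _ ≤ m.choose l * ((l + 1) * levelSum K f (l + 1)) := by gcongr
      _ = _ := by ring
  have mono (l : ℕ) (hkl : k ≤ l) (hl : l ≤ m) :
      levelSum K f k / m.choose k ≤ levelSum K f l / m.choose l := by
    induction l, hkl using Nat.le_induction with
    | base => exact le_rfl
    | succ l _ ih => exact (ih (by omega)).trans (step l (by omega))
  have h := mono (m - k) (by omega) (by omega)
  rw [Nat.choose_symm (by omega)] at h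
  exact (div_le_div_iff_of_pos_right (by exact_mod_cast Nat.choose_pos (by omega))).1 h

theorem sum_mul_odd_nonneg {f : Cube n → ℝ} (hf : Monotone f) (K : Finset (Fin n)) (w : ℕ → ℝ)
    (hodd : ∀ k ≤ K.card, w (K.card - k) = -w k) (hw : ∀ k, K.card ≤ 2 * k → 0 ≤ w k) :
    0 ≤ ∑ x, f x * w (onesIn K x) := by
  set m := K.card with hm
  have e : ∑ x, f x * w (onesIn K x) = ∑ k ∈ Finset.range (m + 1), w k * levelSum K f k := by
    rw [← Finset.sum_fiberwise_of_maps_to (s := Finset.univ) (t := Finset.range (m + 1))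
      (g := onesIn K) fun x _ => Finset.mem_range_succ_iff.2 (onesIn_le K x)]
    refine Finset.sum_congr rfl fun k _ => ?_
    rw [levelSum, Finset.mul_sum]
    refine Finset.sum_congr rfl fun x hx => ?_
    rw [(Finset.mem_filter.1 hx).2, mul_comm]
  have e' : ∑ k ∈ Finset.range (m + 1), w k * levelSum K f k =
      ∑ k ∈ Finset.range (m + 1), -(w k * levelSum K f (m - k)) := by
    rw [← Finset.sum_range_reflect]
    refine Finset.sum_congr rfl fun k hk => ?_
    have hk := Finset.mem_range_succ_iff.1 hk
    rw [Nat.add_sub_cancel, hodd k hk, neg_mul]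
  suffices 0 ≤ ∑ k ∈ Finset.range (m + 1), (w k * levelSum K f k - w k * levelSum K f (m - k)) by
    simp only [sub_eq_add_neg] at this
    rw [Finset.sum_add_distrib, ← e'] at this
    linarith
  refine Finset.sum_nonneg fun k hk => ?_
  have hk := Finset.mem_range_succ_iff.1 hk
  rw [← mul_sub]
  rcases le_total m (2 * k) with h | h
  · have := levelSum_reflect_le hf K (k := m - k) (by omega)
    rw [← hm, Nat.sub_sub_self hk] at this
    exact mul_nonneg (hw k h) (by linarith)
  · have := levelSum_reflect_le hf K (k := k) h
    have hw' := hw (m - k) (by omega)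
    rw [hodd k hk] at hw'
    exact mul_nonneg_of_nonpos_of_nonpos (by linarith) (by linarith)

end Levels

/-! ### Influences, sign sums and majorities. -/

section SignSums

variable {n : ℕ}

/-- The bit `x j` as a sign. -/
def bitSign (j : Fin n) (x : Cube n) : ℝ := if x j then 1 else -1

theorem sum_bitSign (K : Finset (Fin n)) (x : Cube n) :
    ∑ j ∈ K, bitSign j x = 2 * onesIn K x - K.card := by
  have h (j : Fin n) : bitSign j x = 2 * ((x j).toNat : ℝ) - 1 := by
    unfold bitSign; cases x j <;> norm_num
  simp only [h, onesIn, Finset.sum_sub_distrib, ← Finset.mul_sum]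
  simp

theorem majority_eq (K : Finset (Fin n)) (x : Cube n) :
    majority K x = SignType.sign (2 * (onesIn K x : ℝ) - K.card) := by
  have h : ∑ j ∈ K, ((x j).toNat : ℝ) = onesIn K x := by simp [onesIn]
  unfold majority
  rw [h]
  split_ifs with h₁ h₂
  · rw [sign_neg (by linarith)]; simp
  · rw [h₂, show 2 * ((K.card : ℝ) / 2) - K.card = 0 by ring]; simp
  · rw [sign_pos (by rcases lt_or_gt_of_ne h₂ with h | h <;> linarith)]; simp

theorem influence_eq {f : Cube n → ℝ} (hf : Monotone f) (k : Fin n) :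
    influence k f = 2 * expect (fun x => f x * bitSign k x) := by
  have e (x : Cube n) : |f (flipBit k x) - f x| =
      f x * bitSign k x + f (flipBit k x) * bitSign k (flipBit k x) := by
    cases hx : x k
    · have h := hf (le_flipBit hx)
      have hx' : flipBit k x k = true := by simp [flipBit, hx]
      rw [abs_of_nonneg (by linarith)]
      simp [bitSign, hx, hx']; ring
    · have hx' : flipBit k x k = false := by simp [flipBit, hx]
      have h := hf (le_flipBit hx')
      rw [flipBit_involutive k x] at h
      rw [abs_of_nonpos (by linarith)]
      simp [bitSign, hx, hx']; ring
  unfold influence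
  simp only [e]
  rw [expect_add, expect_flipBit k fun x => f x * bitSign k x]
  ring

theorem influence_nonneg (k : Fin n) (f : Cube n → ℝ) : 0 ≤ influence k f :=
  expect_nonneg fun _ => abs_nonneg _

theorem sum_influence_eq {f : Cube n → ℝ} (hf : Monotone f) (K : Finset (Fin n)) :
    ∑ k ∈ K, influence k f = 2 * expect (fun x => f x * (2 * onesIn K x - K.card)) := by
  simp only [influence_eq hf, ← Finset.mul_sum, ← sum_bitSign, expect, ← Finset.sum_div]
  rw [Finset.sum_comm]
  simp only [Finset.mul_sum]

theorem expect_exp_le (K : Finset (Fin n)) (t : ℝ) :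
    expect (fun x => Real.exp (t * (2 * onesIn K x - K.card))) ≤
      Real.exp (K.card * (t ^ 2 / 2)) := by
  have e (x : Cube n) : Real.exp (t * (2 * onesIn K x - K.card)) =
      ∏ j, if j ∈ K then Real.exp (t * if x j then 1 else -1) else 1 := by
    rw [← sum_bitSign, Finset.mul_sum, Real.exp_sum, Finset.prod_ite_mem, Finset.univ_inter]
    rfl
  have p := Finset.prod_univ_sum (fun _ : Fin n => (Finset.univ : Finset Bool))
    (fun j b => if j ∈ K then Real.exp (t * if b then 1 else -1) else 1)
  rw [Fintype.piFinset_univ] at p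
  simp only [expect, e]
  rw [← p, div_le_iff₀ (by positivity)]
  calc ∏ j : Fin n, ∑ b : Bool, (if j ∈ K then Real.exp (t * if b then 1 else -1) else 1)
      ≤ ∏ j : Fin n, (if j ∈ K then Real.exp (t ^ 2 / 2) else 1) * 2 := by
        refine Finset.prod_le_prod (fun j _ => Finset.sum_nonneg fun b _ => ?_) fun j _ => ?_
        · split_ifs <;> positivity
        · have := Real.cosh_le_exp_half_sq t
          rw [Real.cosh_eq] at this
          split_ifs
          · simp; linarith
          · simp
    _ = _ := by
        rw [Finset.prod_mul_distrib, Finset.prod_ite_mem, Finset.univ_inter, Finset.prod_const,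
          Finset.prod_const, ← Real.exp_nat_mul]
        simp

/-- Bound the excess through `y ≤ exp (l * y) / l` with the Chernoff-optimal `l = T / K.card`, then
use the exponential moment for both signs. -/
theorem expect_tail_le (K : Finset (Fin n)) {T : ℝ} (hT : 0 < T) (hK : K.Nonempty) :
    expect (fun x => max (|2 * (onesIn K x : ℝ) - K.card| - T) 0) ≤
      2 * K.card / T * Real.exp (-(T ^ 2 / (2 * K.card))) := by
  have hm : (0 : ℝ) < K.card := by exact_mod_cast hK.card_pos
  set m : ℝ := (K.card : ℝ) with hmdef
  have hl : 0 < T / m := by positivity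
  have pt (x : Cube n) : max (|2 * (onesIn K x : ℝ) - m| - T) 0 ≤
      m / T * Real.exp (-(T ^ 2 / m)) * (Real.exp (T / m * (2 * onesIn K x - m)) +
        Real.exp (-(T / m) * (2 * onesIn K x - m))) := by
    refine max_le ?_ (by positivity)
    set s := 2 * (onesIn K x : ℝ) - m
    have h₁ : |s| - T ≤ m / T * Real.exp (T / m * (|s| - T)) := by
      have := Real.add_one_le_exp (T / m * (|s| - T))
      rw [← div_le_iff₀' (by positivity)]
      have e : (|s| - T) / (m / T) = T / m * (|s| - T) := by field_simp
      linarith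
    refine h₁.trans ?_
    rw [show T / m * (|s| - T) = -(T ^ 2 / m) + T / m * |s| by ring, Real.exp_add, ← mul_assoc]
    refine mul_le_mul_of_nonneg_left ?_ (by positivity)
    rcases abs_cases s with ⟨h, _⟩ | ⟨h, _⟩ <;> rw [h]
    · linarith [Real.exp_pos (-(T / m) * s)]
    · rw [show T / m * -s = -(T / m) * s by ring]
      linarith [Real.exp_pos (T / m * s)]
  refine (expect_mono pt).trans ?_
  rw [expect_const_mul, expect_add]
  have h₁ := expect_exp_le K (T / m)
  have h₂ := expect_exp_le K (-(T / m))
  rw [neg_sq] at h₂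
  rw [← hmdef] at h₁ h₂
  have e₁ : m * ((T / m) ^ 2 / 2) = T ^ 2 / (2 * m) := by field_simp
  have e₂ : Real.exp (-(T ^ 2 / (2 * m))) =
      Real.exp (-(T ^ 2 / m)) * Real.exp (T ^ 2 / (2 * m)) := by
    rw [← Real.exp_add]; congr 1; field_simp; ring
  rw [e₁] at h₁ h₂
  calc _ ≤ m / T * Real.exp (-(T ^ 2 / m)) *
        (Real.exp (T ^ 2 / (2 * m)) + Real.exp (T ^ 2 / (2 * m))) := by gcongr
    _ = _ := by rw [e₂]; ring

theorem abs_expect_le_maxMajCorr (f : Cube n → ℝ) (K : Finset (Fin n)) :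
    |expect (fun x => f x * majority K x)| ≤ maxMajCorr f :=
  Finset.le_sup' (fun K => |expect (fun x => f x * majority K x)|) (Finset.mem_univ K)

theorem maxMajCorr_nonneg (f : Cube n → ℝ) : 0 ≤ maxMajCorr f :=
  (abs_nonneg _).trans (abs_expect_le_maxMajCorr f ∅)

theorem abs_majority_le_one (K : Finset (Fin n)) (x : Cube n) : |majority K x| ≤ 1 := by
  unfold majority; split_ifs <;> norm_num

theorem maxMajCorr_le_one {f : Cube n → ℝ} (hf : ∀ x, f x ∈ Set.Icc (0 : ℝ) 1) :
    maxMajCorr f ≤ 1 := by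
  refine Finset.sup'_le _ _ fun K _ => (abs_expect_le _).trans ?_
  refine (expect_mono fun x => ?_).trans_eq (expect_const 1)
  rw [abs_mul, abs_of_nonneg (hf x).1]
  exact mul_le_one₀ (hf x).2 (abs_nonneg _) (abs_majority_le_one K x)

theorem expect_mul_sum_le {f : Cube n → ℝ} (hf : Monotone f) (h01 : ∀ x, f x ∈ Set.Icc (0 : ℝ) 1)
    {K : Finset (Fin n)} (hK : K.Nonempty) {T : ℝ} (hT : 0 < T) :
    expect (fun x => f x * (2 * onesIn K x - K.card)) ≤
      T * maxMajCorr f + 2 * K.card / T * Real.exp (-(T ^ 2 / (2 * K.card))) := by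
  -- The part of `T` times majority that exceeds the truncated sign sum. It is odd about the middle
  -- level and nonnegative above it, so it can be discarded.
  set w : ℕ → ℝ := fun k => SignType.sign (2 * (k : ℝ) - K.card) *
    max (T - |2 * (k : ℝ) - K.card|) 0 with hw
  have hodd : 0 ≤ expect (fun x => f x * w (onesIn K x)) := by
    refine div_nonneg (sum_mul_odd_nonneg hf K w (fun k hk => ?_) fun k hk => ?_) (by positivity)
    · simp only [hw]
      rw [Nat.cast_sub hk, show 2 * ((K.card : ℝ) - k) - K.card = -(2 * k - K.card) by ring,
        Left.sign_neg, abs_neg]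
      simp
    · have hk' : (K.card : ℝ) ≤ 2 * k := by exact_mod_cast hk
      refine mul_nonneg ?_ (le_max_right _ _)
      rcases hk'.eq_or_lt with h | h
      · simp [h]
      · rw [sign_pos (by linarith)]; simp
  have pt (x : Cube n) : f x * (2 * onesIn K x - K.card) ≤
      T * (f x * majority K x) - f x * w (onesIn K x) +
        max (|2 * (onesIn K x : ℝ) - K.card| - T) 0 := by
    rw [majority_eq]
    simp only [hw]
    set s := 2 * (onesIn K x : ℝ) - K.card
    have hs : s = SignType.sign s * |s| := (sign_mul_abs s).symm
    have hmax : max (T - |s|) 0 = T - |s| + max (|s| - T) 0 := by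
      rcases le_total T |s| with h | h
      · rw [max_eq_right (by linarith), max_eq_left (by linarith)]; ring
      · rw [max_eq_left (by linarith), max_eq_right (by linarith)]; ring
    have hM : (SignType.sign s : ℝ) ≤ 1 := by
      rcases lt_trichotomy s 0 with h | h | h <;> simp [h]
    have hmn : 0 ≤ max (|s| - T) 0 := le_max_right _ _
    have hfM : f x * SignType.sign s ≤ 1 :=
      (mul_le_of_le_one_right (h01 x).1 hM).trans (h01 x).2
    have := mul_le_of_le_one_left hmn hfM
    calc f x * s = T * (f x * SignType.sign s) - f x * (SignType.sign s * max (T - |s|) 0) +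
          f x * SignType.sign s * max (|s| - T) 0 := by
          rw [hmax]; conv_lhs => rw [hs]
          ring
      _ ≤ _ := by linarith
  refine (expect_mono pt).trans ?_
  rw [expect_add, expect_sub, expect_const_mul]
  have h₁ := mul_le_mul_of_nonneg_left
    ((le_abs_self _).trans (abs_expect_le_maxMajCorr f K)) hT.le
  have h₂ := expect_tail_le K hT hK
  linarith

theorem sum_influence_sq_le {f : Cube n → ℝ} (hf : Monotone f)
    (h01 : ∀ x, f x ∈ Set.Icc (0 : ℝ) 1) (hΛ : 0 < maxMajCorr f) (K : Finset (Fin n)) :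
    (∑ k ∈ K, influence k f) ^ 2 ≤
      32 * (maxMajCorr f ^ 2 * (1 - Real.log (maxMajCorr f))) * K.card := by
  rcases K.eq_empty_or_nonempty with rfl | hK
  · simp
  set Λ := maxMajCorr f
  have hlog : Real.log Λ ≤ 0 := Real.log_nonpos hΛ.le (maxMajCorr_le_one h01)
  have hm : (0 : ℝ) < K.card := by exact_mod_cast hK.card_pos
  set m : ℝ := (K.card : ℝ)
  -- This `T` makes the Gaussian factor `Λ / e`, and the 1 in `1 - log Λ` ensures `2 * m / T ≤ T`.
  -- Both error terms are then at most `T * Λ`.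
  set T := Real.sqrt (2 * m * (1 - Real.log Λ)) with hTdef
  have hpos : 0 < 2 * m * (1 - Real.log Λ) := mul_pos (by linarith) (by linarith)
  have hT : 0 < T := Real.sqrt_pos.2 hpos
  have hT2 : T ^ 2 = 2 * m * (1 - Real.log Λ) := Real.sq_sqrt hpos.le
  have h := expect_mul_sum_le hf h01 hK hT
  have hexp : Real.exp (-(T ^ 2 / (2 * m))) ≤ Λ := by
    rw [hT2, mul_div_cancel_left₀ _ (by positivity)]
    calc Real.exp (-(1 - Real.log Λ)) ≤ Real.exp (Real.log Λ) := Real.exp_le_exp.2 (by linarith)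
      _ = Λ := Real.exp_log hΛ
  have hmT : 2 * m / T ≤ T := by
    rw [div_le_iff₀ hT, ← sq, hT2]
    nlinarith
  have hb : 2 * m / T * Real.exp (-(T ^ 2 / (2 * m))) ≤ T * Λ := by gcongr
  have hsum : ∑ k ∈ K, influence k f ≤ 4 * (T * Λ) := by
    rw [sum_influence_eq hf]; linarith
  calc (∑ k ∈ K, influence k f) ^ 2 ≤ (4 * (T * Λ)) ^ 2 :=
        pow_le_pow_left₀ (Finset.sum_nonneg fun k _ => influence_nonneg k f) hsum 2
    _ = 16 * T ^ 2 * Λ ^ 2 := by ring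
    _ = _ := by rw [hT2]; ring

/-- The least of `N` terms is at most their mean, so its square is at most `D / N`; remove it and
induct. -/
theorem sum_sq_le_harmonic {ι : Type*} [DecidableEq ι] {a : ι → ℝ} (ha : ∀ i, 0 ≤ a i) {D : ℝ}
    (s : Finset ι) (h : ∀ t ⊆ s, (∑ i ∈ t, a i) ^ 2 ≤ D * t.card) :
    ∑ i ∈ s, a i ^ 2 ≤ D * harmonic s.card := by
  induction hs : s.card generalizing s with
  | zero => simp [Finset.card_eq_zero.1 hs]
  | succ N ih =>
    obtain ⟨i, hi, hmin⟩ := s.exists_min_image a (Finset.card_pos.1 (by omega))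
    have hc : (s.erase i).card = N := by rw [Finset.card_erase_of_mem hi, hs]; rfl
    have h₁ := ih (s.erase i) (fun t ht => h t (ht.trans (Finset.erase_subset _ _))) hc
    have h₂ := Finset.card_nsmul_le_sum s a (a i) hmin
    rw [hs, nsmul_eq_mul] at h₂
    have h₃ := h s subset_rfl
    rw [hs] at h₃
    have hN : (0 : ℝ) < ((N + 1 : ℕ) : ℝ) := by positivity
    have h₄ : a i ^ 2 ≤ D * ((N + 1 : ℕ) : ℝ)⁻¹ := by
      have := (pow_le_pow_left₀ (mul_nonneg hN.le (ha i)) h₂ 2).trans h₃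
      rw [← div_eq_mul_inv, le_div_iff₀ hN]
      refine le_of_mul_le_mul_right ?_ hN
      linarith
    rw [← Finset.add_sum_erase s _ hi, harmonic_succ]
    push_cast at h₄ ⊢
    linarith

theorem sumSqInfluence_eq_zero {f : Cube n → ℝ} (hf : Monotone f) (hΛ : maxMajCorr f = 0) :
    sumSqInfluence f = 0 := by
  refine Finset.sum_eq_zero fun k _ => ?_
  have h := abs_expect_le_maxMajCorr f {k}
  have e : (fun x => f x * majority {k} x) = fun x => f x * bitSign k x := by
    ext x
    cases hx : x k <;> simp [majority, bitSign, hx]; norm_num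
  rw [hΛ, abs_nonpos_iff, e] at h
  rw [influence_eq hf, h]
  simp

theorem sumSqInfluence_le (hn : 2 ≤ n) {f : Cube n → ℝ} (hf : Monotone f)
    (h01 : ∀ x, f x ∈ Set.Icc (0 : ℝ) 1) :
    sumSqInfluence f ≤ 96 * maxMajCorr f ^ 2 * (1 - Real.log (maxMajCorr f)) * Real.log n := by
  rcases (maxMajCorr_nonneg f).eq_or_lt with h0 | hΛ
  · rw [sumSqInfluence_eq_zero hf h0.symm, ← h0]; simp
  have h := sum_sq_le_harmonic (fun k => influence_nonneg k f) Finset.univ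
    fun K _ => sum_influence_sq_le hf h01 hΛ K
  rw [Finset.card_univ, Fintype.card_fin] at h
  refine h.trans ?_
  have hlog : Real.log (maxMajCorr f) ≤ 0 := Real.log_nonpos hΛ.le (maxMajCorr_le_one h01)
  have hn' : Real.log 2 ≤ Real.log n := Real.log_le_log (by norm_num) (by exact_mod_cast hn)
  -- Since `log 2 > 1/2`, the 1 in `1 + log n` is at most `2 * log n`. Hence the final constant `96
  -- = 32 * 3`.
  have hH : (harmonic n : ℝ) ≤ 3 * Real.log n := by
    linarith [harmonic_le_one_add_log n, Real.log_two_gt_d9]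
  have hB : 0 ≤ 32 * (maxMajCorr f ^ 2 * (1 - Real.log (maxMajCorr f))) :=
    mul_nonneg (by norm_num) (mul_nonneg (sq_nonneg _) (by linarith))
  refine (mul_le_mul_of_nonneg_left hH hB).trans_eq ?_
  ring

end SignSums

end NoiseSensitivity

theorem theorem1p4 :
    (∃ C : ℝ, 0 < C ∧ ∀ (n : ℕ), 2 ≤ n → ∀ f : Cube n → ℝ,
      Monotone f → (∀ x, f x ∈ Set.Icc (0 : ℝ) 1) →
        sumSqInfluence f ≤
          C * maxMajCorr f ^ 2 * (1 - Real.log (maxMajCorr f)) * Real.log n) ∧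
    (∀ (n : ℕ → ℕ) (A : ∀ m, Set (Cube (n m))),
      (∀ m, 2 ≤ n m) → (∀ m, MonotoneEvent (A m)) →
      Tendsto (fun m => maxMajCorr (ind (A m)) ^ 2 *
          (1 - Real.log (maxMajCorr (ind (A m)))) * Real.log (n m)) atTop (𝓝 0) →
        AsympNoiseSensitive A) := by
  refine ⟨⟨96, by norm_num, fun n hn f hf h01 => sumSqInfluence_le hn hf h01⟩,
    fun n A hn hA h => asympNoiseSensitive_of_tendsto_sumSqInfluence A ?_⟩
  have h' := h.const_mul 96
  rw [mul_zero] at h'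
  refine squeeze_zero (fun m => Finset.sum_nonneg fun k _ => sq_nonneg _) (fun m => ?_) h'
  exact (sumSqInfluence_le (hn m) (hA m) (ind_mem_Icc (A m))).trans_eq (by ring)
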